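/- Let $N\ge 2$, $p\in[2,\infty)$, $q=\frac{N+2}{N+p}$, and let $\Omega\subset\mathbb{R}^N$ be a bounded Lipschitz domain, that is, a nonempty bounded connected open set which in a ball around each boundary point is, in the direction of some unit vector, the region strictly above the graph of a Lipschitz function. For $\varepsilon>0$ put $\Omega_\varepsilon=\{x\in\mathbb{R}^N: d(x,\Omega)\le\varepsilon\}$ and $\Gamma_\varepsilon=\Omega_\varepsilon\setminus\overline\Omega$. Let $F\colon\partial\Omega\to\mathbb{R}$ be Lipschitz continuous with constant $K$. A control is a Borel map $\sigma\colon\overline\Omega\to\mathbb{S}^{N-1}$. For a control $\sigma$ and a starting point $x_0\in\Omega_\varepsilon$, let $(x_n)_{n\ge0}$ be the Markov chain with law $\mathbb{P}^{x_0}_\sigma$, started at $x_0$, with transition probabilities $$\gamma[x]=q\,\frac{|B_\varepsilon(x)\cap\,\cdot\,|}{|B_\varepsilon(x)|}+\frac{1-q}{2}\bigl(\delta_{x+\varepsilon\sigma(x)}+\delta_{x-\varepsilon\sigma(x)}\bigr)\ \text{ for } x\in\overline\Omega,\qquad \gamma[x]=\delta_x\ \text{ for } x\in\Gamma_\varepsilon,$$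 and let $\tau_\sigma=\min\{n\ge 0: x_n\in\Gamma_\varepsilon\}$, which is finite almost surely. Extend $F$ to $\partial\Omega\cup\Gamma_\varepsilon$ with the same Lipschitz constant $K$, and let $$u_\varepsilon(x_0)=\sup_\sigma\,\mathbb{E}^{x_0}_\sigma[F(x_{\tau_\sigma})],$$ the supremum being taken over all controls $\sigma$. Then for every $\eta>0$ there are $\varepsilon_0>0$ and $\varepsilon_1>0$ such that, for all $y_0\in\partial\Omega$, all $0<\varepsilon<\varepsilon_0$, every such extension of $F$ and all $x\in B_{\varepsilon_1}(y_0)\cap\overline\Omega$, $$|u_\varepsilon(x)-F(y_0)|\le\eta.$$ -/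

import Mathlib

open MeasureTheory ProbabilityTheory Set Metric
open scoped NNReal ENNReal

noncomputable section

namespace DominativeGame

/-- The Euclidean space `ℝ^N`. -/
abbrev E (N : ℕ) : Type := EuclideanSpace ℝ (Fin N)

variable {N : ℕ}

/-- A bounded Lipschitz domain: a nonempty, bounded, connected open set which, in a ball around
each of its boundary points, is the region strictly above the graph of a Lipschitz function, in
the direction of some unit vector `e`.
The point `x - ⟪e, x⟫ e` is the orthogonal projection of `x` to the hyperplane `e^⊥`, so only the
values of `φ` on that hyperplane matter. -/
structure IsBoundedLipschitzDomain (Ω : Set (E N)) : Prop where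
  isOpen : IsOpen Ω
  isConnected : IsConnected Ω
  isBounded : Bornology.IsBounded Ω
  boundary : ∀ y ∈ frontier Ω, ∃ (r : ℝ) (e : E N) (L : ℝ≥0) (φ : E N → ℝ),
    0 < r ∧ ‖e‖ = 1 ∧ LipschitzWith L φ ∧
      ∀ x ∈ ball y r, x ∈ Ω ↔ φ (x - inner ℝ e x • e) < inner ℝ e x

/-- `Ω_ε = {x : d(x, Ω) ≤ ε}`. -/
def enlarged (Ω : Set (E N)) (ε : ℝ) : Set (E N) := cthickening ε Ω

/-- The outer strip `Γ_ε = Ω_ε \ closure Ω`. -/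
def outerStrip (Ω : Set (E N)) (ε : ℝ) : Set (E N) := enlarged Ω ε \ closure Ω

/-- `q = (N + 2) / (N + p)`, the probability of a uniformly distributed step. -/
def qOf (N : ℕ) (p : ℝ) : ℝ := (N + 2) / (N + p)

/-- A control: a Borel map from the closure of `Ω` to the unit sphere. -/
def Control (Ω : Set (E N)) : Type :=
  {σ : closure Ω → sphere (0 : E N) 1 // Measurable σ}

open Classical in
/-- The transition probability `γ[x]`. For `x ∈ closure Ω` the next point is uniformly distributed
in the ball `B_ε(x)` with probability `q`, and it is `x + ε σ(x)` or `x - ε σ(x)` with probability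
`(1 - q) / 2` each. At the other points, in particular on `Γ_ε`, the process stays where it is. -/
def stepMeasure (p ε : ℝ) {Ω : Set (E N)} (σ : Control Ω) (x : E N) : Measure (E N) :=
  if h : x ∈ closure Ω then
    ENNReal.ofReal (qOf N p) • cond volume (ball x ε) +
      ENNReal.ofReal ((1 - qOf N p) / 2) •
        (Measure.dirac (x + ε • (σ.1 ⟨x, h⟩ : E N)) + Measure.dirac (x - ε • (σ.1 ⟨x, h⟩ : E N)))
  else Measure.dirac x

theorem measurable_cond_ball (ε : ℝ) :
    Measurable fun x : E N => cond (volume : Measure (E N)) (ball x ε) := by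
  refine Measure.measurable_of_measurable_coe _ fun A hA => ?_
  simp only [cond_apply measurableSet_ball, Measure.addHaar_ball_center]
  refine Measurable.const_mul ?_ _
  have hS : MeasurableSet {z : E N × E N | z.2 ∈ ball z.1 ε ∩ A} := by
    exact (measurableSet_lt (measurable_snd.dist measurable_fst) measurable_const).inter
      (measurable_snd hA)
  exact measurable_measure_prodMk_left hS

theorem measurable_stepMeasure (p ε : ℝ) {Ω : Set (E N)} (σ : Control Ω) :
    Measurable (stepMeasure p ε σ) := by
  classical
  have hσ : Measurable fun x : closure Ω => (σ.1 x : E N) := measurable_subtype_coe.comp σ.2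
  have hx : Measurable fun x : closure Ω => (x : E N) := measurable_subtype_coe
  have h1 : Measurable fun x : closure Ω =>
      ENNReal.ofReal (qOf N p) • cond volume (ball (x : E N) ε) +
      ENNReal.ofReal ((1 - qOf N p) / 2) •
        (Measure.dirac ((x : E N) + ε • (σ.1 x : E N)) +
          Measure.dirac ((x : E N) - ε • (σ.1 x : E N))) := by
    have ha : Measurable fun x : closure Ω => (x : E N) + ε • (σ.1 x : E N) :=
      hx.add (hσ.const_smul ε)
    have hb : Measurable fun x : closure Ω => (x : E N) - ε • (σ.1 x : E N) :=
      hx.sub (hσ.const_smul ε)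
    refine Measure.measurable_of_measurable_coe _ fun A hA => ?_
    simp only [Measure.add_apply, Measure.smul_apply, smul_eq_mul]
    have e0 := (Measure.measurable_coe hA).comp ((measurable_cond_ball ε).comp hx)
    have e1 := (Measure.measurable_coe hA).comp (Measure.measurable_dirac.comp ha)
    have e2 := (Measure.measurable_coe hA).comp (Measure.measurable_dirac.comp hb)
    exact (e0.const_mul _).add ((e1.add e2).const_mul _)
  have h2 : Measurable fun x : ((closure Ω)ᶜ : Set (E N)) => Measure.dirac (x : E N) :=
    Measure.measurable_dirac.comp measurable_subtype_coe
  exact Measurable.dite (s := closure Ω) h1 h2 isClosed_closure.measurableSet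

theorem qOf_nonneg (N : ℕ) {p : ℝ} (hp : 2 ≤ p) : 0 ≤ qOf N p := by
  unfold qOf; positivity

theorem qOf_le_one (N : ℕ) {p : ℝ} (hp : 2 ≤ p) : qOf N p ≤ 1 := by
  unfold qOf
  rw [div_le_one (by positivity)]
  linarith

theorem isProbabilityMeasure_stepMeasure {p ε : ℝ} (hp : 2 ≤ p) (hε : 0 < ε) {Ω : Set (E N)}
    (σ : Control Ω) (x : E N) : IsProbabilityMeasure (stepMeasure p ε σ x) := by
  unfold stepMeasure
  split_ifs with h
  · have h0 : (volume : Measure (E N)) (ball x ε) ≠ 0 := (measure_ball_pos volume x hε).ne'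
    have hfin : (volume : Measure (E N)) (ball x ε) ≠ ∞ := measure_ball_lt_top.ne
    have : IsProbabilityMeasure (cond (volume : Measure (E N)) (ball x ε)) :=
      cond_isProbabilityMeasure_of_finite h0 hfin
    have hq := qOf_nonneg N hp
    have hq1 := qOf_le_one N hp
    refine ⟨?_⟩
    simp only [Measure.add_apply, Measure.smul_apply, smul_eq_mul, measure_univ, mul_one]
    rw [← ENNReal.ofReal_one, ← ENNReal.ofReal_add (by norm_num) (by norm_num),
      ← ENNReal.ofReal_mul (by linarith), ← ENNReal.ofReal_add hq (by linarith)]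
    congr 1
    ring
  · infer_instance

/-- The transition probabilities as a Markov kernel on `ℝ^N`. -/
def stepKernel (p ε : ℝ) {Ω : Set (E N)} (σ : Control Ω) : Kernel (E N) (E N) :=
  ⟨stepMeasure p ε σ, measurable_stepMeasure p ε σ⟩

/-- The transition from the history `(x₀, …, x_n)` to `x_{n+1}`, which depends on `x_n` only. -/
def historyKernel (p ε : ℝ) {Ω : Set (E N)} (σ : Control Ω) (n : ℕ) :
    Kernel ((_ : Finset.Iic n) → E N) (E N) :=
  (stepKernel p ε σ).comap (fun h => h ⟨n, Finset.mem_Iic.2 le_rfl⟩) (measurable_pi_apply _)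

theorem isMarkovKernel_historyKernel {p ε : ℝ} (hp : 2 ≤ p) (hε : 0 < ε) {Ω : Set (E N)}
    (σ : Control Ω) (n : ℕ) : IsMarkovKernel (historyKernel p ε σ n) :=
  ⟨fun h => isProbabilityMeasure_stepMeasure hp hε σ (h ⟨n, Finset.mem_Iic.2 le_rfl⟩)⟩

/-- The law `ℙ^{x₀}_σ` of the process `(x₀, x₁, x₂, …)` started at `x₀`, obtained from the
transition probabilities by the Ionescu-Tulcea theorem. -/
def pathLaw {p ε : ℝ} (hp : 2 ≤ p) (hε : 0 < ε) {Ω : Set (E N)} (σ : Control Ω) (x₀ : E N) :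
    Measure (ℕ → E N) :=
  haveI := isMarkovKernel_historyKernel hp hε σ
  Kernel.traj (X := fun _ => E N) (historyKernel p ε σ) 0 (fun _ => x₀)

open Classical in
/-- The exit time `τ(ω) = min {n : x_n ∈ Γ_ε}`, with `min ∅ = ∞`. -/
def exitTime (Ω : Set (E N)) (ε : ℝ) (ω : ℕ → E N) : ℕ∞ :=
  if ∃ n, ω n ∈ outerStrip Ω ε then ((sInf {n | ω n ∈ outerStrip Ω ε} : ℕ) : ℕ∞) else ⊤

open Classical in
/-- The payoff `F(x_τ)`; on the null event `τ = ∞` it is set to `0`. -/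
def payoff (Ω : Set (E N)) (ε : ℝ) (F : E N → ℝ) (ω : ℕ → E N) : ℝ :=
  if exitTime Ω ε ω = ⊤ then 0 else F (ω (exitTime Ω ε ω).toNat)

/-- The `ε`-stochastic solution `u_ε(x₀) = sup_σ 𝔼^{x₀}_σ[F(x_τ)]`. -/
def stochasticSolution {p ε : ℝ} (hp : 2 ≤ p) (hε : 0 < ε) (Ω : Set (E N)) (F : E N → ℝ)
    (x₀ : E N) : ℝ :=
  ⨆ σ : Control Ω, ∫ ω, payoff Ω ε F ω ∂(pathLaw hp hε σ x₀)

end DominativeGame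

end

/-! Why it is true: it suffices that the process started close to `y₀` exits close to `y₀` with high
probability, uniformly in the control, in `y₀` and in small `ε`. This is a barrier argument at
shrinking scales.

Whatever the control, one step is symmetric about the current point, and its uniform component alone
gives variance at least `spread N p * ε ^ 2` in every unit direction. Symmetry removes first-order
terms, and for a steep enough Gaussian bump the variance term beats the loss from curvature away
from the centre. So the bump rises on average (`gaussian_mul_le_integral`), and one minus the bump
is a supersolution.

The Lipschitz boundary supplies centres `z` near `y₀`, at every small scale `r`, whose distance from
`closure Ω` is at least `ρ * r` (`IsBoundedLipschitzDomain.exists_exterior_ball`). Pasting the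
resulting supersolutions (`IsBarrier.exists_next`) gains a fixed factor below `1` each time the
radius shrinks by `8`. After `n` scales the barrier is at most `barrierRatio ^ n` near `y₀` and
still `1` beyond distance `δ`.

Along the process the barrier is a supermartingale, so its starting value bounds the probability of
exiting beyond `δ`, and the Lipschitz bound on the payoff finishes (`abs_integral_payoff_sub_le`).
No estimate depends on the control, hence all survive the supremum. -/

noncomputable section

namespace DominativeGame

variable {N : ℕ} {p ε : ℝ} {Ω : Set (E N)}

/-! ### Symmetry and variance of one step -/

/-- A lower bound for the normalized variance of one step in any direction. -/
def spread (N : ℕ) (p : ℝ) : ℝ := qOf N p * (1 / 4) ^ N / 16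

theorem spread_pos (hN : 2 ≤ N) (hp : 2 ≤ p) : 0 < spread N p := by
  unfold spread qOf
  have : 0 < (N : ℝ) := by positivity
  positivity

theorem spread_le_one (N : ℕ) (hp : 2 ≤ p) : spread N p ≤ 1 := by
  unfold spread
  have h1 := qOf_le_one N hp
  have h0 := qOf_nonneg N hp
  have h2 : ((1 : ℝ) / 4) ^ N ≤ 1 := pow_le_one₀ (by norm_num) (by norm_num)
  have h3 : (0 : ℝ) ≤ (1 / 4) ^ N := by positivity
  nlinarith

theorem stepMeasure_of_mem (p ε : ℝ) (σ : Control Ω) {x : E N} (hx : x ∈ closure Ω) :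
    stepMeasure p ε σ x = ENNReal.ofReal (qOf N p) • cond volume (ball x ε) +
      ENNReal.ofReal ((1 - qOf N p) / 2) •
        (Measure.dirac (x + ε • (σ.1 ⟨x, hx⟩ : E N)) +
          Measure.dirac (x - ε • (σ.1 ⟨x, hx⟩ : E N))) := by
  unfold stepMeasure
  rw [dif_pos hx]

theorem stepMeasure_of_notMem (p ε : ℝ) (σ : Control Ω) {x : E N} (hx : x ∉ closure Ω) :
    stepMeasure p ε σ x = Measure.dirac x := by
  unfold stepMeasure
  rw [dif_neg hx]

theorem norm_control (σ : Control Ω) (x : closure Ω) : ‖(σ.1 x : E N)‖ = 1 := by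
  simp

theorem ae_dist_le_stepMeasure (p : ℝ) (hε : 0 < ε) (σ : Control Ω) {x : E N}
    (hx : x ∈ closure Ω) : ∀ᵐ y ∂(stepMeasure p ε σ x), dist y x ≤ ε := by
  have hm : MeasurableSet {y : E N | dist y x ≤ ε} := isClosed_closedBall.measurableSet
  have hn := norm_control σ ⟨x, hx⟩
  rw [stepMeasure_of_mem p ε σ hx, ae_add_measure_iff]
  refine ⟨Measure.ae_smul_measure ?_ _, Measure.ae_smul_measure ?_ _⟩
  · filter_upwards [ae_cond_mem (μ := (volume : Measure (E N))) (s := ball x ε)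
      measurableSet_ball] with y hy using (mem_ball.1 hy).le
  · rw [ae_add_measure_iff, ae_dirac_iff hm, ae_dirac_iff hm]
    simp [dist_eq_norm, norm_smul, hn, abs_of_pos hε]

/-- The two controlled jumps are swapped by the reflection through `x`, and the ball is invariant
under it. This is what makes first-order terms cancel for every control. -/
theorem measurePreserving_reflection_stepMeasure (p ε : ℝ) (σ : Control Ω) {x : E N}
    (hx : x ∈ closure Ω) :
    MeasurePreserving (fun y => (x + x) - y) (stepMeasure p ε σ x) (stepMeasure p ε σ x) := by
  have hmeas : Measurable fun y : E N => (x + x) - y := by fun_prop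
  refine ⟨hmeas, ?_⟩
  have hb : (cond (volume : Measure (E N)) (ball x ε)).map (fun y => (x + x) - y) =
      cond (volume : Measure (E N)) (ball x ε) := by
    unfold ProbabilityTheory.cond
    have hpre : (fun y : E N => (x + x) - y) ⁻¹' ball x ε = ball x ε := by
      ext y
      simp only [mem_preimage, mem_ball, dist_eq_norm]
      rw [show x + x - y - x = -(y - x) by abel, norm_neg]
    rw [Measure.map_smul]
    congr 1
    have := ((Measure.measurePreserving_sub_left (volume : Measure (E N)) (x + x)).restrict_preimage
      (s := ball x ε) measurableSet_ball).map_eq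
    rwa [hpre] at this
  rw [stepMeasure_of_mem p ε σ hx, Measure.map_add _ _ hmeas, Measure.map_smul, Measure.map_smul,
    Measure.map_add _ _ hmeas, Measure.map_dirac' hmeas, Measure.map_dirac' hmeas, hb]
  congr 2
  rw [show x + x - (x + ε • (σ.1 ⟨x, hx⟩ : E N)) = x - ε • (σ.1 ⟨x, hx⟩ : E N) by abel,
    show x + x - (x - ε • (σ.1 ⟨x, hx⟩ : E N)) = x + ε • (σ.1 ⟨x, hx⟩ : E N) by abel, add_comm]

theorem integrable_of_bound_on_step (hp : 2 ≤ p) (hε : 0 < ε) (σ : Control Ω) {x : E N}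
    (hx : x ∈ closure Ω) {f : E N → ℝ} (hf : Measurable f) (C : ℝ)
    (hC : ∀ y, dist y x ≤ ε → |f y| ≤ C) : Integrable f (stepMeasure p ε σ x) := by
  have := isProbabilityMeasure_stepMeasure hp hε σ x
  refine Integrable.of_bound hf.aestronglyMeasurable C ?_
  filter_upwards [ae_dist_le_stepMeasure p hε σ hx] with y hy using hC y hy

/-- Only the uniform component is counted, so the bound cannot be spoiled by the control. -/
theorem measure_subball_le (hp : 2 ≤ p) (hε : 0 < ε) (σ : Control Ω) {x : E N}
    (hx : x ∈ closure Ω) {c : E N} (hc : ball c (ε / 4) ⊆ ball x ε) :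
    qOf N p * (1 / 4) ^ N ≤ (stepMeasure p ε σ x).real (ball c (ε / 4)) := by
  have := isProbabilityMeasure_stepMeasure hp hε σ x
  have hq := qOf_nonneg N hp
  rw [← ENNReal.ofReal_le_ofReal_iff measureReal_nonneg, ofReal_measureReal,
    ENNReal.ofReal_mul hq]
  rw [stepMeasure_of_mem p ε σ hx, Measure.add_apply, Measure.smul_apply, smul_eq_mul]
  refine le_trans ?_ le_self_add
  gcongr
  rw [cond_apply measurableSet_ball, inter_eq_right.2 hc]
  have h0 : (volume : Measure (E N)) (ball x ε) ≠ 0 := (measure_ball_pos volume x hε).ne'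
  have hfin : (volume : Measure (E N)) (ball x ε) ≠ ∞ := measure_ball_lt_top.ne
  have key : (volume : Measure (E N)) (ball c (ε / 4)) =
      ENNReal.ofReal ((1 / 4) ^ N) * volume (ball x ε) := by
    rw [show ε / 4 = (1 / 4) * ε by ring, Measure.addHaar_ball_mul_of_pos _ _ (by norm_num),
      Measure.addHaar_ball_center, Measure.addHaar_ball_center _ x]
    simp
  rw [key, mul_comm, mul_assoc, ENNReal.mul_inv_cancel h0 hfin, mul_one]

theorem spread_le_integral_inner_sq (hp : 2 ≤ p) (hε : 0 < ε) (σ : Control Ω) {x : E N}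
    (hx : x ∈ closure Ω) (u : E N) :
    spread N p * ‖u‖ ^ 2 * ε ^ 2 ≤ ∫ y, (inner ℝ u (y - x)) ^ 2 ∂(stepMeasure p ε σ x) := by
  have := isProbabilityMeasure_stepMeasure hp hε σ x
  rcases eq_or_ne u 0 with rfl | hu
  · simp
  have hu' : 0 < ‖u‖ := norm_pos_iff.2 hu
  have hmeas : Measurable fun y : E N => (inner ℝ u (y - x)) ^ 2 :=
    (by fun_prop : Continuous fun y : E N => (inner ℝ u (y - x)) ^ 2).measurable
  have hint : Integrable (fun y : E N => (inner ℝ u (y - x)) ^ 2) (stepMeasure p ε σ x) := by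
    refine integrable_of_bound_on_step hp hε σ hx hmeas ((‖u‖ * ε) ^ 2) fun y hy => ?_
    rw [abs_pow]
    have h := abs_real_inner_le_norm u (y - x)
    rw [dist_eq_norm] at hy
    gcongr
    exact h.trans (by gcongr)
  -- On the ball of radius `ε / 4` about this point, at distance `ε / 2` from `x` along `u`, the
  -- inner product is at least `‖u‖ * ε / 4`. Markov's inequality then bounds the second moment.
  set c : E N := x + (ε / (2 * ‖u‖)) • u with hc
  have hcx : ‖c - x‖ = ε / 2 := by
    rw [hc, add_sub_cancel_left, norm_smul, Real.norm_of_nonneg (by positivity)]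
    field_simp
  have hsub : ball c (ε / 4) ⊆ ball x ε := by
    refine ball_subset_ball' ?_
    rw [dist_eq_norm, hcx]; linarith
  have hbound : ball c (ε / 4) ⊆ {y | (‖u‖ * ε / 4) ^ 2 ≤ (inner ℝ u (y - x)) ^ 2} := by
    intro y hy
    rw [mem_ball, dist_eq_norm] at hy
    have h1 : inner ℝ u (y - x) = inner ℝ u (y - c) + ‖u‖ * ε / 2 := by
      rw [show y - x = (y - c) + (ε / (2 * ‖u‖)) • u by rw [hc]; abel, inner_add_right,
        inner_smul_right, real_inner_self_eq_norm_sq]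
      field_simp
    have h2 := (abs_le.1 (abs_real_inner_le_norm u (y - c))).1
    have h3 : ‖u‖ * ‖y - c‖ ≤ ‖u‖ * (ε / 4) := by gcongr
    have h4 : ‖u‖ * ε / 4 ≤ inner ℝ u (y - x) := by rw [h1]; linarith
    exact pow_le_pow_left₀ (by positivity) h4 2
  have hmark := mul_meas_ge_le_integral_of_nonneg (μ := stepMeasure p ε σ x)
    (Filter.Eventually.of_forall fun y => sq_nonneg (inner ℝ u (y - x))) hint ((‖u‖ * ε / 4) ^ 2)
  refine le_trans ?_ hmark
  have h5 := (measure_subball_le hp hε σ hx hsub).trans (measureReal_mono hbound)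
  calc spread N p * ‖u‖ ^ 2 * ε ^ 2 = (‖u‖ * ε / 4) ^ 2 * (qOf N p * (1 / 4) ^ N) := by
        unfold spread; ring
    _ ≤ _ := by gcongr

/-! ### Gaussian bumps as strict subsolutions -/

theorem one_add_sq_div_two_le_cosh (t : ℝ) : 1 + t ^ 2 / 2 ≤ Real.cosh t := by
  have h1 : Real.cosh t = 1 + 2 * Real.sinh (t / 2) ^ 2 := by
    have := Real.cosh_two_mul (t / 2)
    rw [show 2 * (t / 2) = t by ring, Real.cosh_sq] at this
    rw [this]; ring
  have h2 : (t / 2) ^ 2 ≤ Real.sinh (t / 2) ^ 2 := by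
    rcases le_total 0 (t / 2) with h | h
    · exact pow_le_pow_left₀ h (Real.self_le_sinh_iff.2 h) 2
    · have := Real.sinh_le_self_iff.2 h
      nlinarith
  rw [h1]; nlinarith

/-- The Gaussian bump centred at `z`. -/
def gaussian (l : ℝ) (z y : E N) : ℝ := Real.exp (-(l * ‖y - z‖ ^ 2))

theorem continuous_gaussian (l : ℝ) (z : E N) : Continuous (gaussian l z) := by
  unfold gaussian; fun_prop

theorem gaussian_pos (l : ℝ) (z y : E N) : 0 < gaussian l z y := Real.exp_pos _

theorem gaussian_le_one {l : ℝ} (hl : 0 ≤ l) (z y : E N) : gaussian l z y ≤ 1 :=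
  Real.exp_le_one_iff.2 (neg_nonpos.2 (by positivity))

/-- Averaging over `y` and its reflection turns the exponential of the cross term into a `cosh`,
which is bounded below by its quadratic part. -/
theorem gaussian_add_reflection_ge {l : ℝ} (hl : 0 ≤ l) {x y z : E N}
    (hy : dist y x ≤ ε) :
    gaussian l z x * ((1 - l * ε ^ 2) * (1 + 2 * l ^ 2 * (inner ℝ (x - z) (y - x)) ^ 2)) ≤
      (gaussian l z y + gaussian l z (x + x - y)) / 2 := by
  set u := x - z with hu
  set ξ := y - x with hξ
  have e1 : y - z = u + ξ := by rw [hu, hξ]; abel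
  have e2 : x + x - y - z = u - ξ := by rw [hu, hξ]; abel
  have hsum : (gaussian l z y + gaussian l z (x + x - y)) / 2 =
      gaussian l z x * (Real.exp (-(l * ‖ξ‖ ^ 2)) * Real.cosh (2 * l * inner ℝ u ξ)) := by
    unfold gaussian
    rw [e1, e2, ← hu, norm_add_sq_real u ξ, norm_sub_sq_real u ξ, Real.cosh_eq,
      show -(l * (‖u‖ ^ 2 + 2 * inner ℝ u ξ + ‖ξ‖ ^ 2)) =
        -(l * ‖u‖ ^ 2) + (-(l * ‖ξ‖ ^ 2) + -(2 * l * inner ℝ u ξ)) by ring,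
      show -(l * (‖u‖ ^ 2 - 2 * inner ℝ u ξ + ‖ξ‖ ^ 2)) =
        -(l * ‖u‖ ^ 2) + (-(l * ‖ξ‖ ^ 2) + (2 * l * inner ℝ u ξ)) by ring]
    simp only [Real.exp_add]
    ring
  rw [hsum]
  have hξε : ‖ξ‖ ^ 2 ≤ ε ^ 2 := by
    rw [dist_eq_norm] at hy
    exact pow_le_pow_left₀ (norm_nonneg _) hy 2
  have h1 : 1 - l * ε ^ 2 ≤ Real.exp (-(l * ‖ξ‖ ^ 2)) := by
    have := Real.add_one_le_exp (-(l * ‖ξ‖ ^ 2))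
    have := mul_le_mul_of_nonneg_left hξε hl
    linarith
  have h2 : 1 + 2 * l ^ 2 * (inner ℝ u ξ) ^ 2 ≤ Real.cosh (2 * l * inner ℝ u ξ) := by
    have := one_add_sq_div_two_le_cosh (2 * l * inner ℝ u ξ)
    linarith [this, show (2 * l * inner ℝ u ξ) ^ 2 / 2 = 2 * l ^ 2 * (inner ℝ u ξ) ^ 2 by ring]
  exact mul_le_mul_of_nonneg_left (mul_le_mul h1 h2 (by positivity) (Real.exp_pos _).le)
    (gaussian_pos _ _ _).le

/-- Far enough from its centre, a Gaussian bump strictly increases on average in one step. -/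
theorem gaussian_mul_le_integral (hp : 2 ≤ p) (hε : 0 < ε) (σ : Control Ω) {x z : E N}
    (hx : x ∈ closure Ω) {l : ℝ} (hl : 0 ≤ l) (hle : l * ε ^ 2 ≤ 1 / 2)
    (hs : 2 ≤ l * (spread N p * ‖x - z‖ ^ 2)) :
    gaussian l z x * (1 + l * ε ^ 2) ≤ ∫ y, gaussian l z y ∂(stepMeasure p ε σ x) := by
  have := isProbabilityMeasure_stepMeasure hp hε σ x
  have hmp := measurePreserving_reflection_stepMeasure p ε σ hx
  have hg : Integrable (gaussian l z) (stepMeasure p ε σ x) :=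
    Integrable.of_bound (continuous_gaussian l z).measurable.aestronglyMeasurable 1
      (Filter.Eventually.of_forall fun y => by
        rw [Real.norm_of_nonneg (gaussian_pos _ _ _).le]; exact gaussian_le_one hl z y)
  have hg' : Integrable (fun y => gaussian l z (x + x - y)) (stepMeasure p ε σ x) :=
    hmp.integrable_comp_of_integrable hg
  have hrefl : ∫ y, gaussian l z (x + x - y) ∂(stepMeasure p ε σ x) =
      ∫ y, gaussian l z y ∂(stepMeasure p ε σ x) := by
    have := integral_map (μ := stepMeasure p ε σ x) hmp.measurable.aemeasurable
      (f := gaussian l z) (by rw [hmp.map_eq]; exact hg.aestronglyMeasurable)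
    rw [hmp.map_eq] at this
    exact this.symm
  have hi : Integrable (fun y : E N => (inner ℝ (x - z) (y - x)) ^ 2) (stepMeasure p ε σ x) := by
    refine integrable_of_bound_on_step hp hε σ hx
      (by fun_prop : Continuous fun y : E N => (inner ℝ (x - z) (y - x)) ^ 2).measurable
      ((‖x - z‖ * ε) ^ 2) fun y hy => ?_
    rw [abs_pow]
    have h := abs_real_inner_le_norm (x - z) (y - x)
    rw [dist_eq_norm] at hy
    gcongr
    exact h.trans (by gcongr)
  have hmono : ∫ y, gaussian l z x * ((1 - l * ε ^ 2) *
        (1 + 2 * l ^ 2 * (inner ℝ (x - z) (y - x)) ^ 2)) ∂(stepMeasure p ε σ x) ≤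
      ∫ y, (gaussian l z y + gaussian l z (x + x - y)) / 2 ∂(stepMeasure p ε σ x) := by
    refine integral_mono_ae ?_ ((hg.add hg').div_const 2) ?_
    · exact ((((integrable_const _).add (hi.const_mul _)).const_mul _).const_mul _)
    · filter_upwards [ae_dist_le_stepMeasure p hε σ hx] with y hy
        using gaussian_add_reflection_ge hl hy
  rw [integral_div, integral_add hg hg', hrefl, integral_const_mul, integral_const_mul,
    integral_add (integrable_const _) (hi.const_mul _), integral_const_mul] at hmono
  simp only [integral_const, probReal_univ, one_smul] at hmono
  have hvar := spread_le_integral_inner_sq hp hε σ hx (x - z)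
  set I := ∫ y, (inner ℝ (x - z) (y - x)) ^ 2 ∂(stepMeasure p ε σ x)
  have h1 : 4 * (l * ε ^ 2) ≤ 2 * l ^ 2 * I := by
    calc 4 * (l * ε ^ 2) = 2 * (l * ε ^ 2) * 2 := by ring
      _ ≤ 2 * (l * ε ^ 2) * (l * (spread N p * ‖x - z‖ ^ 2)) := by gcongr
      _ = 2 * l ^ 2 * (spread N p * ‖x - z‖ ^ 2 * ε ^ 2) := by ring
      _ ≤ _ := by gcongr
  -- With `t = l * ε ^ 2`, the right side is at least `(1 - t) * (1 + 4 * t)`, which exceeds `1 + t`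
  -- by `2 * t * (1 - 2 * t) ≥ 0`.
  have h2 : 1 + l * ε ^ 2 ≤ (1 - l * ε ^ 2) * (1 + 2 * l ^ 2 * I) := by
    have ht : 0 ≤ l * ε ^ 2 := by positivity
    nlinarith
  have h3 := mul_le_mul_of_nonneg_left h2 (gaussian_pos l z x).le
  linarith

/-! ### Exterior balls at Lipschitz boundaries -/

/-- Near `y`, the complement of the region above the graph contains a ball of radius comparable
to `r` at distance at most `r` from each boundary point. -/
theorem exists_exterior_ball_of_graph {y : E N} {r : ℝ} {e : E N} {L : ℝ≥0} {φ : E N → ℝ}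
    (he : ‖e‖ = 1) (hφ : LipschitzWith L φ)
    (hΩ : ∀ x ∈ ball y r, x ∈ Ω ↔ φ (x - inner ℝ e x • e) < inner ℝ e x)
    {w : E N} (hw : w ∈ ball y (r / 2)) (hwΩ : w ∉ Ω) {s : ℝ} (hs : 0 < s) (hsr : s ≤ r / 4) :
    ∃ z, dist z w ≤ s ∧ Disjoint (ball z (1 / (1 + L) * s)) Ω := by
  have hρ : 1 / (1 + (L : ℝ)) ≤ 1 := by
    rw [div_le_one (by positivity)]; simp
  have hρs : 1 / (1 + (L : ℝ)) * s ≤ s := mul_le_of_le_one_left hs.le hρ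
  -- Descending by `s` below the graph leaves room: a displacement `d` can recover at most `(1 + L)
  -- * ‖d‖` of that height, which is less than `s` in the chosen ball.
  refine ⟨w - s • e, ?_, ?_⟩
  · rw [dist_eq_norm]; simp [norm_smul, he, abs_of_pos hs]
  rw [Set.disjoint_left]
  intro x hx hxΩ
  rw [mem_ball, dist_eq_norm] at hx
  have hwy := mem_ball.1 hw
  have hxw : ‖x - w‖ < 2 * s := by
    calc ‖x - w‖ = ‖(x - (w - s • e)) + (-(s • e))‖ := by congr 1; abel
      _ ≤ ‖x - (w - s • e)‖ + ‖-(s • e)‖ := norm_add_le _ _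
      _ < s + s := by
        have : ‖-(s • e)‖ = s := by simp [norm_smul, he, abs_of_pos hs]
        linarith
      _ = 2 * s := by ring
  have hxr : x ∈ ball y r := by
    rw [mem_ball]
    have := dist_triangle x w y
    rw [dist_eq_norm x w] at this
    linarith
  have hwr : w ∈ ball y r := by
    rw [mem_ball]
    linarith [dist_nonneg (x := w) (y := y)]
  have h1 := (hΩ x hxr).1 hxΩ
  have h2 : inner ℝ e w ≤ φ (w - inner ℝ e w • e) :=
    not_lt.1 fun h => hwΩ ((hΩ w hwr).2 h)
  set d := x - (w - s • e) with hd
  have hee : inner ℝ e e = (1 : ℝ) := by rw [real_inner_self_eq_norm_sq, he]; norm_num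
  have hinner : inner ℝ e x = inner ℝ e w - s + inner ℝ e d := by
    rw [hd, inner_sub_right, inner_sub_right, inner_smul_right, hee]; ring
  have hproj : (w - inner ℝ e w • e) - (x - inner ℝ e x • e) = -(d - inner ℝ e d • e) := by
    rw [hinner, hd]; module
  have hnorm : ‖d - inner ℝ e d • e‖ ≤ ‖d‖ := by
    rw [← sq_le_sq₀ (norm_nonneg _) (norm_nonneg _), norm_sub_sq_real, norm_smul,
      inner_smul_right, real_inner_comm, he]
    simp only [mul_one, Real.norm_eq_abs, sq_abs]
    nlinarith [sq_nonneg (inner ℝ e d)]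
  have h3 := (abs_le.1 (Real.dist_eq _ _ ▸
    hφ.dist_le_mul (w - inner ℝ e w • e) (x - inner ℝ e x • e))).2
  rw [dist_eq_norm, hproj, norm_neg] at h3
  have h4 : inner ℝ e d ≤ ‖d‖ := by
    have := real_inner_le_norm e d
    rwa [he, one_mul] at this
  have h5 : (L : ℝ) * ‖d - inner ℝ e d • e‖ ≤ L * ‖d‖ := by gcongr
  have h6 : (1 + (L : ℝ)) * ‖d‖ < s := by
    have : (0 : ℝ) < 1 + L := by positivity
    calc (1 + (L : ℝ)) * ‖d‖ < (1 + L) * (1 / (1 + L) * s) := by gcongr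
      _ = s := by field_simp
  linarith

/-- A bounded Lipschitz domain satisfies a uniform exterior corkscrew condition. -/
theorem IsBoundedLipschitzDomain.exists_exterior_ball (hΩ : IsBoundedLipschitzDomain Ω) :
    ∃ r₀ > 0, ∃ ρ > 0, ρ ≤ 1 ∧ ∀ y ∈ frontier Ω, ∀ r, 0 < r → r ≤ r₀ →
      ∃ z, dist z y ≤ r ∧ ∀ x ∈ closure Ω, ρ * r ≤ ‖x - z‖ := by
  have hcomp : IsCompact (frontier Ω) :=
    isCompact_of_isClosed_isBounded isClosed_frontier
      (hΩ.isBounded.closure.subset frontier_subset_closure)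
  -- The repeated membership is deliberate: the compactness induction replaces the first `frontier
  -- Ω` by arbitrary sets `S`.
  have key : ∃ r₀ > 0, ∃ ρ > 0, ρ ≤ (1 : ℝ) ∧ ∀ y ∈ frontier Ω, y ∈ frontier Ω →
      ∀ r : ℝ, 0 < r → r ≤ r₀ → ∃ z, dist z y ≤ r ∧ Disjoint (ball z (ρ * r)) Ω := by
    refine hcomp.induction_on (p := fun S => ∃ r₀ > 0, ∃ ρ > 0, ρ ≤ (1 : ℝ) ∧ ∀ y ∈ S,
      y ∈ frontier Ω → ∀ r : ℝ, 0 < r → r ≤ r₀ →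
        ∃ z, dist z y ≤ r ∧ Disjoint (ball z (ρ * r)) Ω) ?_ ?_ ?_ ?_
    · exact ⟨1, one_pos, 1, one_pos, le_rfl, by simp⟩
    · rintro S T hST ⟨r₀, hr₀, ρ, hρ, hρ1, h⟩
      exact ⟨r₀, hr₀, ρ, hρ, hρ1, fun y hy => h y (hST hy)⟩
    · rintro S T ⟨r₀, hr₀, ρ, hρ, hρ1, h⟩ ⟨r₁, hr₁, ρ', hρ', hρ1', h'⟩
      refine ⟨min r₀ r₁, lt_min hr₀ hr₁, min ρ ρ', lt_min hρ hρ', (min_le_left _ _).trans hρ1, ?_⟩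
      rintro y (hy | hy) hyf r hr hrr
      · obtain ⟨z, hz, hd⟩ := h y hy hyf r hr (hrr.trans (min_le_left _ _))
        refine ⟨z, hz, hd.mono_left (ball_subset_ball ?_)⟩
        gcongr
        exact min_le_left _ _
      · obtain ⟨z, hz, hd⟩ := h' y hy hyf r hr (hrr.trans (min_le_right _ _))
        refine ⟨z, hz, hd.mono_left (ball_subset_ball ?_)⟩
        gcongr
        exact min_le_right _ _
    · intro y hy
      obtain ⟨r, e, L, φ, hr, he, hφ, hloc⟩ := hΩ.boundary y hy
      refine ⟨ball y (r / 2), mem_nhdsWithin_of_mem_nhds (ball_mem_nhds y (by positivity)),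
        r / 4, by positivity, 1 / (1 + (L : ℝ)), by positivity, ?_, fun w hw hwf s hs hsr => ?_⟩
      · rw [div_le_one (by positivity)]; simp
      · refine exists_exterior_ball_of_graph he hφ hloc hw (fun h => ?_) hs hsr
        rw [hΩ.isOpen.frontier_eq] at hwf
        exact hwf.2 h
  obtain ⟨r₀, hr₀, ρ, hρ, hρ1, h⟩ := key
  refine ⟨r₀, hr₀, ρ, hρ, hρ1, fun y hy r hr hrr => ?_⟩
  obtain ⟨z, hz, hd⟩ := h y hy hy r hr hrr
  refine ⟨z, hz, fun x hx => ?_⟩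
  by_contra! hlt
  rw [← dist_eq_norm] at hlt
  exact Set.disjoint_left.1 (hd.closure_right isOpen_ball) (mem_ball.2 hlt) hx

/-! ### Barriers and iteration over scales -/

/-- A `[0, 1]`-valued supersolution for the control `σ` which equals `1` outside the ball of
radius `δ` about `y₀` and is at most `m` in the ball of radius `r`. -/
structure IsBarrier (p ε : ℝ) (σ : Control Ω) (y₀ : E N) (δ r m : ℝ) (v : E N → ℝ) : Prop where
  measurable : Measurable v
  nonneg : ∀ x, 0 ≤ v x
  le_one : ∀ x, v x ≤ 1
  eq_one : ∀ x, δ ≤ dist x y₀ → v x = 1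
  le_of_dist_le : ∀ x, dist x y₀ ≤ r → v x ≤ m
  integral_le : ∀ x ∈ closure Ω, ∫ y, v y ∂(stepMeasure p ε σ x) ≤ v x

/-- The exponent of the Gaussian barrier at unit scale. -/
def barrierExponent (N : ℕ) (p ρ : ℝ) : ℝ := 2 / (spread N p * ρ ^ 2)

/-- The factor by which barriers decrease from one scale to the next. -/
def barrierRatio (N : ℕ) (p ρ : ℝ) : ℝ :=
  (1 - Real.exp (-(4 * barrierExponent N p ρ))) / (1 - Real.exp (-(9 * barrierExponent N p ρ)))

theorem barrierExponent_pos (hN : 2 ≤ N) (hp : 2 ≤ p) {ρ : ℝ} (hρ : 0 < ρ) :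
    0 < barrierExponent N p ρ := by
  have := spread_pos hN hp
  unfold barrierExponent
  positivity

theorem barrierRatio_nonneg (hN : 2 ≤ N) (hp : 2 ≤ p) {ρ : ℝ} (hρ : 0 < ρ) :
    0 ≤ barrierRatio N p ρ := by
  have h := barrierExponent_pos hN hp hρ
  exact div_nonneg (sub_nonneg.2 (Real.exp_le_one_iff.2 (by linarith)))
    (sub_nonneg.2 (Real.exp_le_one_iff.2 (by linarith)))

theorem barrierRatio_lt_one (hN : 2 ≤ N) (hp : 2 ≤ p) {ρ : ℝ} (hρ : 0 < ρ) :
    barrierRatio N p ρ < 1 := by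
  have h := barrierExponent_pos hN hp hρ
  have h9 : Real.exp (-(9 * barrierExponent N p ρ)) < 1 := Real.exp_lt_one_iff.2 (by linarith)
  have h49 : Real.exp (-(9 * barrierExponent N p ρ)) < Real.exp (-(4 * barrierExponent N p ρ)) :=
    Real.exp_lt_exp.2 (by linarith)
  unfold barrierRatio
  rw [div_lt_one (by linarith)]
  linarith

/-- One step of the iteration: a Gaussian barrier at scale `r / 8`, centred at an exterior point,
is pasted into the given barrier. -/
theorem IsBarrier.exists_next (hN : 2 ≤ N) (hp : 2 ≤ p) (hε : 0 < ε) {σ : Control Ω} {y₀ z : E N}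
    {ρ δ r m : ℝ} {v : E N → ℝ} (hv : IsBarrier p ε σ y₀ δ (8 * r) m v) (hρ : 0 < ρ) (hρ1 : ρ ≤ 1)
    (hr : 0 < r) (hrδ : 8 * r ≤ δ) (hm : 0 ≤ m) (hεr : ε ≤ spread N p * ρ / 4 * r)
    (hz : dist z y₀ ≤ r) (hzΩ : ∀ x ∈ closure Ω, ρ * r ≤ ‖x - z‖) :
    ∃ v', IsBarrier p ε σ y₀ δ r (barrierRatio N p ρ * m) v' := by
  have hs := spread_pos hN hp
  have hs1 := spread_le_one N hp
  set A := barrierExponent N p ρ with hA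
  have hApos : 0 < A := barrierExponent_pos hN hp hρ
  set l := A / r ^ 2 with hl
  have hl0 : 0 < l := by positivity
  have hlr : l * r ^ 2 = A := by rw [hl]; field_simp
  -- Normalizes `w` to be at least `1` where `dist x y₀ ≥ 4 * r`, since there `‖x - z‖ ≥ 3 * r`.
  -- Within `r` of `y₀` one has `‖x - z‖ ≤ 2 * r`, whence the `4` in `barrierRatio`.
  set D := 1 - Real.exp (-(9 * A)) with hD
  have hDpos : 0 < D := sub_pos.2 (Real.exp_lt_one_iff.2 (by linarith))
  set w : E N → ℝ := fun x => (1 - gaussian l z x) / D with hw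
  have hwmeas : Measurable w := by
    have := (continuous_gaussian l z).measurable
    exact (measurable_const.sub this).div_const _
  have hw0 : ∀ x, 0 ≤ w x := fun x =>
    div_nonneg (sub_nonneg.2 (gaussian_le_one hl0.le z x)) hDpos.le
  have hwle : ∀ x, w x ≤ 1 / D := fun x => by
    have := gaussian_pos l z x
    exact div_le_div_of_nonneg_right (by linarith) hDpos.le
  have hwfar : ∀ x, 4 * r ≤ dist x y₀ → 1 ≤ w x := by
    intro x hx
    have h3 : 3 * r ≤ ‖x - z‖ := by
      rw [← dist_eq_norm]
      linarith [dist_triangle x z y₀]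
    rw [hw, le_div_iff₀ hDpos, one_mul, hD]
    have : gaussian l z x ≤ Real.exp (-(9 * A)) := by
      refine Real.exp_le_exp.2 (neg_le_neg ?_)
      calc 9 * A = l * (3 * r) ^ 2 := by rw [← hlr]; ring
        _ ≤ _ := by gcongr
    linarith
  have hwnear : ∀ x, dist x y₀ ≤ r → w x ≤ barrierRatio N p ρ := by
    intro x hx
    have h2 : ‖x - z‖ ≤ 2 * r := by
      rw [← dist_eq_norm]
      linarith [dist_triangle_right x z y₀]
    refine div_le_div_of_nonneg_right ?_ hDpos.le
    have : Real.exp (-(4 * A)) ≤ gaussian l z x := by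
      refine Real.exp_le_exp.2 (neg_le_neg ?_)
      calc l * ‖x - z‖ ^ 2 ≤ l * (2 * r) ^ 2 := by gcongr
        _ = 4 * A := by rw [← hlr]; ring
    linarith
  have hlε : l * ε ^ 2 ≤ 1 / 2 := by
    have h1 : l * (spread N p * ρ / 4 * r) ^ 2 = spread N p / 8 := by
      rw [show l * (spread N p * ρ / 4 * r) ^ 2 = (l * r ^ 2) * (spread N p * ρ / 4) ^ 2 by ring,
        hlr, hA, barrierExponent]
      field_simp
      norm_num
    have h2 : l * ε ^ 2 ≤ l * (spread N p * ρ / 4 * r) ^ 2 := by gcongr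
    linarith
  have hprob := isProbabilityMeasure_stepMeasure (N := N) hp hε σ
  have hwint : ∀ x, Integrable w (stepMeasure p ε σ x) := fun x =>
    Integrable.of_bound hwmeas.aestronglyMeasurable (1 / D)
      (Filter.Eventually.of_forall fun y => by
        rw [Real.norm_of_nonneg (hw0 y)]; exact hwle y)
  have hwsuper : ∀ x ∈ closure Ω, ∫ y, w y ∂(stepMeasure p ε σ x) ≤ w x := by
    intro x hx
    have hxz := hzΩ x hx
    have hcond : 2 ≤ l * (spread N p * ‖x - z‖ ^ 2) := by
      calc 2 = A * (spread N p * ρ ^ 2) := by rw [hA, barrierExponent]; field_simp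
        _ = l * (spread N p * (ρ * r) ^ 2) := by rw [← hlr]; ring
        _ ≤ _ := by gcongr
    have hg := gaussian_mul_le_integral hp hε σ hx hl0.le hlε hcond
    have hgi : Integrable (gaussian l z) (stepMeasure p ε σ x) :=
      Integrable.of_bound (continuous_gaussian l z).measurable.aestronglyMeasurable 1
        (Filter.Eventually.of_forall fun y => by
          rw [Real.norm_of_nonneg (gaussian_pos _ _ _).le]; exact gaussian_le_one hl0.le z y)
    rw [hw, integral_div, integral_sub (integrable_const _) hgi, integral_const, probReal_univ,
      one_smul]
    refine div_le_div_of_nonneg_right ?_ hDpos.le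
    have h1 := gaussian_pos l z x
    have h2 : 0 ≤ gaussian l z x * (l * ε ^ 2) := by positivity
    linarith
  have hvint : ∀ x, Integrable v (stepMeasure p ε σ x) := fun x =>
    Integrable.of_bound hv.measurable.aestronglyMeasurable 1
      (Filter.Eventually.of_forall fun y => by
        rw [Real.norm_of_nonneg (hv.nonneg y)]; exact hv.le_one y)
  classical
  -- Between radii `4 * r` and `8 * r` the minimum is already `v`, so the pasting has no seam. A
  -- step from inside radius `4 * r` has length at most `ε ≤ r` and never sees the outer branch.
  set v' : E N → ℝ := fun x => if dist x y₀ < 8 * r then min (v x) (m * w x) else v x with hv'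
  have hle : ∀ x, v' x ≤ v x := fun x => by
    simp only [hv']; split_ifs; exacts [min_le_left _ _, le_rfl]
  have hlew : ∀ x, dist x y₀ < 8 * r → v' x ≤ m * w x := fun x hx => by
    simp only [hv', if_pos hx]; exact min_le_right _ _
  have hfar : ∀ x, 4 * r ≤ dist x y₀ → v' x = v x := fun x hx => by
    simp only [hv']
    split_ifs with h
    · refine min_eq_left ((hv.le_of_dist_le x h.le).trans ?_)
      exact le_mul_of_one_le_right hm (hwfar x hx)
    · rfl
  have hnonneg : ∀ x, 0 ≤ v' x := fun x => by
    simp only [hv']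
    split_ifs
    exacts [le_min (hv.nonneg x) (mul_nonneg hm (hw0 x)), hv.nonneg x]
  have hmeas : Measurable v' :=
    Measurable.ite (measurableSet_lt (measurable_id.dist measurable_const) measurable_const)
      (hv.measurable.min (hwmeas.const_mul m)) hv.measurable
  have hv'int : ∀ x, Integrable v' (stepMeasure p ε σ x) := fun x =>
    Integrable.of_bound hmeas.aestronglyMeasurable 1
      (Filter.Eventually.of_forall fun y => by
        rw [Real.norm_of_nonneg (hnonneg y)]; exact (hle y).trans (hv.le_one y))
  refine ⟨v', hmeas, hnonneg, fun x => (hle x).trans (hv.le_one x), fun x hx => ?_, fun x hx => ?_,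
    fun x hx => ?_⟩
  · rw [hfar x (by linarith), hv.eq_one x hx]
  · refine (hlew x (by linarith)).trans ?_
    rw [mul_comm]
    exact mul_le_mul_of_nonneg_right (hwnear x hx) hm
  · have hlev : ∫ y, v' y ∂(stepMeasure p ε σ x) ≤ v x :=
      (integral_mono (hv'int x) (hvint x) hle).trans (hv.integral_le x hx)
    rcases le_or_gt (4 * r) (dist x y₀) with hx4 | hx4
    · rwa [hfar x hx4]
    · simp only [hv', if_pos (show dist x y₀ < 8 * r by linarith)]
      refine le_min hlev ?_
      calc ∫ y, v' y ∂(stepMeasure p ε σ x) ≤ ∫ y, m * w y ∂(stepMeasure p ε σ x) := by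
            refine integral_mono_ae (hv'int x) ((hwint x).const_mul m) ?_
            filter_upwards [ae_dist_le_stepMeasure p hε σ hx] with y hy
            refine hlew y ?_
            have h1 : ε ≤ r := hεr.trans (mul_le_of_le_one_left hr.le (by nlinarith))
            linarith [dist_triangle y x y₀]
        _ = m * ∫ y, w y ∂(stepMeasure p ε σ x) := integral_const_mul _ _
        _ ≤ m * w x := by gcongr; exact hwsuper x hx

/-- Iterates `IsBarrier.exists_next` from the constant barrier `1`. Smallness of `ε` at the finest
scale implies it at all coarser ones. -/
theorem exists_isBarrier (hN : 2 ≤ N) (hp : 2 ≤ p) {ρ δ : ℝ} (hρ : 0 < ρ) (hρ1 : ρ ≤ 1)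
    (hδ : 0 < δ) {y₀ : E N} (hext : ∀ r, 0 < r → r ≤ δ →
      ∃ z, dist z y₀ ≤ r ∧ ∀ x ∈ closure Ω, ρ * r ≤ ‖x - z‖) (hε : 0 < ε) (σ : Control Ω) (n : ℕ)
    (hεn : ε ≤ spread N p * ρ / 4 * (δ / 8 ^ n)) :
    ∃ v, IsBarrier p ε σ y₀ δ (δ / 8 ^ n) (barrierRatio N p ρ ^ n) v := by
  have hs := spread_pos hN hp
  have hprob := isProbabilityMeasure_stepMeasure (N := N) hp hε σ
  induction n with
  | zero =>
    refine ⟨fun _ => 1, measurable_const, fun _ => zero_le_one, fun _ => le_rfl, fun _ _ => rfl,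
      fun _ _ => by simp, fun x _ => by simp⟩
  | succ n ih =>
    have h8 : 8 * (δ / 8 ^ (n + 1)) = δ / 8 ^ n := by
      rw [pow_succ]; field_simp
    have hr : 0 < δ / 8 ^ (n + 1) := by positivity
    have hle : δ / 8 ^ n ≤ δ := div_le_self hδ.le (one_le_pow₀ (by norm_num))
    obtain ⟨v, hv⟩ := ih (hεn.trans (by gcongr <;> simp))
    obtain ⟨z, hz, hzΩ⟩ := hext (δ / 8 ^ (n + 1)) hr (by linarith)
    rw [← h8] at hv
    have := hv.exists_next hN hp hε hρ hρ1 hr (by linarith)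
      (pow_nonneg (barrierRatio_nonneg hN hp hρ) n) hεn hz hzΩ
    rwa [← pow_succ'] at this

/-! ### Markov property of the path law -/

theorem isMarkovKernel_stepKernel (hp : 2 ≤ p) (hε : 0 < ε) (σ : Control Ω) :
    IsMarkovKernel (stepKernel p ε σ) :=
  ⟨fun x => isProbabilityMeasure_stepMeasure hp hε σ x⟩

theorem isProbabilityMeasure_pathLaw (hp : 2 ≤ p) (hε : 0 < ε) (σ : Control Ω) (x₀ : E N) :
    IsProbabilityMeasure (pathLaw hp hε σ x₀) := by
  have := isMarkovKernel_historyKernel hp hε σ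
  unfold pathLaw
  infer_instance

/-- The law of two consecutive positions. -/
theorem map_pathLaw_pair (hp : 2 ≤ p) (hε : 0 < ε) (σ : Control Ω) (x₀ : E N) (n : ℕ) :
    (pathLaw hp hε σ x₀).map (fun ω => (ω n, ω (n + 1))) =
      ((pathLaw hp hε σ x₀).map (fun ω => ω n)).compProd (stepKernel p ε σ) := by
  have := isMarkovKernel_historyKernel hp hε σ
  have := isMarkovKernel_stepKernel hp hε σ
  have := isProbabilityMeasure_pathLaw hp hε σ x₀
  refine Measure.ext_of_lintegral _ fun f hf => ?_
  have hpair : Measurable fun ω : ℕ → E N => (ω n, ω (n + 1)) := by fun_prop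
  have heval : Measurable fun ω : ℕ → E N => ω n := by fun_prop
  have hinner : Measurable fun x => ∫⁻ y, f (x, y) ∂(stepKernel p ε σ x) :=
    hf.lintegral_kernel_prod_right'
  have hfp : Measurable fun ω : ℕ → E N => f (ω n, ω (n + 1)) := hf.comp hpair
  have hin : Measurable fun ω : ℕ → E N => ∫⁻ y, f (ω n, y) ∂(stepKernel p ε σ (ω n)) :=
    hinner.comp heval
  rw [lintegral_map hf hpair, Measure.lintegral_compProd hf, lintegral_map hinner heval]
  unfold pathLaw
  set x : (_ : Finset.Iic 0) → E N := fun _ => x₀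
  have hcond : ∀ h : (_ : Finset.Iic n) → E N,
      ∫⁻ ω, f (ω n, ω (n + 1)) ∂(Kernel.traj (X := fun _ => E N) (historyKernel p ε σ) n h) =
        ∫⁻ y, f (h ⟨n, Finset.mem_Iic.2 le_rfl⟩, y)
          ∂(stepKernel p ε σ (h ⟨n, Finset.mem_Iic.2 le_rfl⟩)) := by
    intro h
    rw [Kernel.lintegral_traj h hfp]
    have h1 : ∀ ω : ℕ → E N, (f (Function.updateFinset ω (Finset.Iic n) h n,
        Function.updateFinset ω (Finset.Iic n) h (n + 1))) =
        f (h ⟨n, Finset.mem_Iic.2 le_rfl⟩, ω (n + 1)) := by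
      intro ω
      simp [Function.updateFinset]
    simp only [h1]
    have h2 : stepKernel p ε σ (h ⟨n, Finset.mem_Iic.2 le_rfl⟩) =
        (Kernel.traj (X := fun _ => E N) (historyKernel p ε σ) n h).map (fun ω => ω (n + 1)) := by
      rw [← Kernel.map_apply _ (measurable_pi_apply _), Kernel.map_traj_succ_self]
      rfl
    rw [h2, lintegral_map (by fun_prop) (measurable_pi_apply _)]
  -- Disintegrating at time `n` reduces both sides to integrals over the history, compared pointwise
  -- by `hcond`.
  rw [← Kernel.traj_comp_partialTraj (zero_le (a := n)), Kernel.lintegral_comp _ _ _ hfp,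
    Kernel.lintegral_comp _ _ _ hin]
  refine lintegral_congr fun h => ?_
  rw [hcond, Kernel.lintegral_traj h hin]
  simp [Function.updateFinset]

theorem ae_pathLaw_zero (hp : 2 ≤ p) (hε : 0 < ε) (σ : Control Ω) (x₀ : E N) :
    ∀ᵐ ω ∂(pathLaw hp hε σ x₀), ω 0 = x₀ := by
  have := isMarkovKernel_historyKernel hp hε σ
  have hm : MeasurableSet {h : (_ : Finset.Iic 0) → E N | h ⟨0, Finset.mem_Iic.2 le_rfl⟩ = x₀} :=
    measurableSet_eq_fun (measurable_pi_apply _) measurable_const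
  have h1 : (pathLaw hp hε σ x₀).map (Preorder.frestrictLe (π := fun _ => E N) 0) =
      Measure.dirac (fun _ => x₀) := by
    unfold pathLaw
    rw [Kernel.traj_map_frestrictLe_apply, Kernel.partialTraj_self, Kernel.id_apply]
  have h2 : ∀ᵐ h ∂((pathLaw hp hε σ x₀).map (Preorder.frestrictLe (π := fun _ => E N) 0)),
      h ⟨0, Finset.mem_Iic.2 le_rfl⟩ = x₀ := by
    rw [h1, ae_dirac_iff hm]
  exact ae_of_ae_map (by fun_prop) h2

/-- A property of consecutive positions which holds almost surely for one step holds almost surely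
along the process. -/
theorem ae_pathLaw_step (hp : 2 ≤ p) (hε : 0 < ε) (σ : Control Ω) (x₀ : E N)
    {S : Set (E N × E N)} (hS : MeasurableSet S)
    (h : ∀ x, ∀ᵐ y ∂(stepMeasure p ε σ x), (x, y) ∈ S) :
    ∀ᵐ ω ∂(pathLaw hp hε σ x₀), ∀ n, (ω n, ω (n + 1)) ∈ S := by
  have := isMarkovKernel_stepKernel hp hε σ
  have := isProbabilityMeasure_pathLaw hp hε σ x₀
  refine ae_all_iff.2 fun n => ?_
  have h1 : ∀ᵐ z ∂((pathLaw hp hε σ x₀).map (fun ω => (ω n, ω (n + 1)))), z ∈ S := by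
    rw [map_pathLaw_pair, Measure.ae_compProd_iff (p := fun z => z ∈ S) hS]
    exact Filter.Eventually.of_forall h
  exact ae_of_ae_map (by fun_prop) h1

theorem integral_pathLaw_succ (hp : 2 ≤ p) (hε : 0 < ε) (σ : Control Ω) (x₀ : E N) (n : ℕ)
    {f : E N → ℝ} (hf : Measurable f) {C : ℝ} (hC : ∀ x, |f x| ≤ C) :
    ∫ ω, f (ω (n + 1)) ∂(pathLaw hp hε σ x₀) =
      ∫ ω, ∫ y, f y ∂(stepMeasure p ε σ (ω n)) ∂(pathLaw hp hε σ x₀) := by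
  have := isMarkovKernel_stepKernel hp hε σ
  have := isProbabilityMeasure_pathLaw hp hε σ x₀
  have hpair : Measurable fun ω : ℕ → E N => (ω n, ω (n + 1)) := by fun_prop
  have heval : Measurable fun ω : ℕ → E N => ω n := by fun_prop
  have hprob : IsProbabilityMeasure ((pathLaw hp hε σ x₀).map (fun ω => ω n)) :=
    Measure.isProbabilityMeasure_map heval.aemeasurable
  have hf2 : Measurable fun z : E N × E N => f z.2 := hf.comp measurable_snd
  have h1 : ∫ ω, f (ω (n + 1)) ∂(pathLaw hp hε σ x₀) =
      ∫ z, f z.2 ∂((pathLaw hp hε σ x₀).map (fun ω => (ω n, ω (n + 1)))) :=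
    (integral_map hpair.aemeasurable hf2.aestronglyMeasurable).symm
  rw [h1, map_pathLaw_pair, Measure.integral_compProd
    (Integrable.of_bound hf2.aestronglyMeasurable C (Filter.Eventually.of_forall fun z => hC z.2)),
    integral_map heval.aemeasurable]
  · rfl
  · exact (StronglyMeasurable.integral_kernel_prod_right'
      hf2.stronglyMeasurable).aestronglyMeasurable

/-! ### Absorption in the strip and exit estimates -/

theorem measurableSet_outerStrip (Ω : Set (E N)) (ε : ℝ) : MeasurableSet (outerStrip Ω ε) :=
  isClosed_cthickening.measurableSet.diff isClosed_closure.measurableSet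

theorem ae_mem_enlarged (hp : 2 ≤ p) (hε : 0 < ε) (σ : Control Ω) {x₀ : E N}
    (hx₀ : x₀ ∈ closure Ω) :
    ∀ᵐ ω ∂(pathLaw hp hε σ x₀), ∀ n, ω n ∈ enlarged Ω ε := by
  have hm : MeasurableSet (enlarged Ω ε) := isClosed_cthickening.measurableSet
  have hS : MeasurableSet {z : E N × E N | z.1 ∈ enlarged Ω ε → z.2 ∈ enlarged Ω ε} :=
    (measurable_fst hm).imp (measurable_snd hm)
  have hstep := ae_pathLaw_step hp hε σ x₀ hS fun x => by
    by_cases hx : x ∈ closure Ω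
    · filter_upwards [ae_dist_le_stepMeasure p hε σ hx] with y hy _
      show y ∈ cthickening ε Ω
      rw [← cthickening_closure]
      exact mem_cthickening_of_dist_le y x ε _ hx hy
    · rw [stepMeasure_of_notMem p ε σ hx, ae_dirac_iff (measurable_prodMk_left hS)]
      exact id
  filter_upwards [hstep, ae_pathLaw_zero hp hε σ x₀] with ω hω h0 n
  induction n with
  | zero => rw [h0]; exact closure_subset_cthickening ε Ω hx₀
  | succ n ih => exact hω n ih

theorem ae_absorbed (hp : 2 ≤ p) (hε : 0 < ε) (σ : Control Ω) (x₀ : E N) :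
    ∀ᵐ ω ∂(pathLaw hp hε σ x₀), ∀ n, ω n ∉ closure Ω → ω (n + 1) = ω n := by
  have hS : MeasurableSet {z : E N × E N | z.1 ∉ closure Ω → z.2 = z.1} :=
    (measurable_fst isClosed_closure.measurableSet.compl).imp
      (measurableSet_eq_fun measurable_snd measurable_fst)
  refine ae_pathLaw_step hp hε σ x₀ hS fun x => ?_
  by_cases hx : x ∈ closure Ω
  · exact Filter.Eventually.of_forall fun y h => absurd hx h
  · rw [stepMeasure_of_notMem p ε σ hx, ae_dirac_iff (measurable_prodMk_left hS)]
    exact fun _ => rfl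

/-- Along an absorbed path the payoff is eventually read off from the current position. -/
theorem tendsto_payoff (Ω : Set (E N)) (ε : ℝ) (G : E N → ℝ) {ω : ℕ → E N}
    (hω : ∀ n, ω n ∉ closure Ω → ω (n + 1) = ω n) :
    Filter.Tendsto (fun n => (outerStrip Ω ε).indicator G (ω n)) Filter.atTop
      (nhds (payoff Ω ε G ω)) := by
  by_cases h : ∃ n, ω n ∈ outerStrip Ω ε
  · set m := sInf {n | ω n ∈ outerStrip Ω ε} with hm
    have hmem : ω m ∈ outerStrip Ω ε := Nat.sInf_mem h
    have hconst : ∀ k, m ≤ k → ω k = ω m := by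
      intro k hk
      induction k, hk using Nat.le_induction with
      | base => rfl
      | succ k hk ih =>
        rw [hω k (by rw [ih]; exact hmem.2), ih]
    have hpay : payoff Ω ε G ω = G (ω m) := by
      simp [payoff, exitTime, h, ← hm]
    rw [hpay]
    refine tendsto_const_nhds.congr' ?_
    filter_upwards [Filter.eventually_ge_atTop m] with k hk
    rw [hconst k hk, indicator_of_mem hmem]
  · have hpay : payoff Ω ε G ω = 0 := by
      simp [payoff, exitTime, h]
    rw [hpay]
    refine tendsto_const_nhds.congr fun n => ?_
    rw [indicator_of_notMem fun hn => h ⟨n, hn⟩]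

theorem integrable_comp_eval (hp : 2 ≤ p) (hε : 0 < ε) (σ : Control Ω) (x₀ : E N) (n : ℕ)
    {f : E N → ℝ} (hf : Measurable f) {C : ℝ} (hC : ∀ x, |f x| ≤ C) :
    Integrable (fun ω => f (ω n)) (pathLaw hp hε σ x₀) := by
  have := isProbabilityMeasure_pathLaw hp hε σ x₀
  exact Integrable.of_bound (hf.comp (measurable_pi_apply n)).aestronglyMeasurable C
    (Filter.Eventually.of_forall fun ω => hC (ω n))

theorem integrable_integral_stepMeasure (hp : 2 ≤ p) (hε : 0 < ε) (σ : Control Ω) (x₀ : E N)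
    (n : ℕ) {f : E N → ℝ} (hf : Measurable f) {C : ℝ} (hC : ∀ x, |f x| ≤ C) :
    Integrable (fun ω => ∫ y, f y ∂(stepMeasure p ε σ (ω n))) (pathLaw hp hε σ x₀) := by
  have := isMarkovKernel_stepKernel hp hε σ
  have hprob := isProbabilityMeasure_stepMeasure (N := N) hp hε σ
  refine integrable_comp_eval hp hε σ x₀ n (f := fun x => ∫ y, f y ∂(stepMeasure p ε σ x))
    (StronglyMeasurable.integral_kernel (κ := stepKernel p ε σ)
      hf.stronglyMeasurable).measurable (C := C) fun x => ?_
  have := norm_integral_le_of_norm_le_const (μ := stepMeasure p ε σ x)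
    (f := f) (C := C) (Filter.Eventually.of_forall fun y => hC y)
  simpa using this

/-- Supermartingale property: inside `closure Ω` it is the barrier inequality, outside the process
does not move. -/
theorem IsBarrier.integral_pathLaw_le (hp : 2 ≤ p) (hε : 0 < ε) {σ : Control Ω} {y₀ : E N}
    {δ r m : ℝ} {v : E N → ℝ} (hv : IsBarrier p ε σ y₀ δ r m v) (x₀ : E N) (n : ℕ) :
    ∫ ω, v (ω n) ∂(pathLaw hp hε σ x₀) ≤ v x₀ := by
  have := isProbabilityMeasure_pathLaw hp hε σ x₀
  have hC : ∀ x, |v x| ≤ 1 := fun x => by rw [abs_of_nonneg (hv.nonneg x)]; exact hv.le_one x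
  induction n with
  | zero =>
    rw [integral_congr_ae (g := fun _ => v x₀)
      (by filter_upwards [ae_pathLaw_zero hp hε σ x₀] with ω h; rw [h])]
    simp
  | succ n ih =>
    rw [integral_pathLaw_succ hp hε σ x₀ n hv.measurable hC]
    refine (integral_mono (integrable_integral_stepMeasure hp hε σ x₀ n hv.measurable hC)
      (integrable_comp_eval hp hε σ x₀ n hv.measurable hC) fun ω => ?_).trans ih
    by_cases hx : ω n ∈ closure Ω
    · exact hv.integral_le _ hx
    · simp only [stepMeasure_of_notMem p ε σ hx]
      rw [integral_dirac' _ _ hv.measurable.stronglyMeasurable]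

/-- The process leaves the closure of a bounded set almost surely. -/
theorem tendsto_integral_indicator_closure (hN : 2 ≤ N) (hp : 2 ≤ p) (hε : 0 < ε)
    (hΩ : Bornology.IsBounded Ω) (σ : Control Ω) (x₀ : E N) :
    Filter.Tendsto (fun n => ∫ ω, (closure Ω).indicator (fun _ => (1 : ℝ)) (ω n)
      ∂(pathLaw hp hε σ x₀)) Filter.atTop (nhds 0) := by
  have := isProbabilityMeasure_pathLaw hp hε σ x₀
  have hs := spread_pos hN hp
  obtain ⟨D, hD0, hD⟩ := hΩ.closure.exists_pos_norm_le
  have : Nonempty (Fin N) := ⟨⟨0, by omega⟩⟩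
  -- Here `ε` is fixed, so one bump suffices, centred so far away that it rises on all of `closure
  -- Ω`. Each step there gains at least `c` while the bump stays below `1`, so the expected time
  -- spent there is at most `1 / c`.
  set l := 1 / (2 * ε ^ 2) with hl
  have hl0 : 0 < l := by positivity
  have hlε : l * ε ^ 2 = 1 / 2 := by rw [hl]; field_simp
  set R := Real.sqrt (2 / (l * spread N p)) with hR
  have hR0 : 0 ≤ R := Real.sqrt_nonneg _
  obtain ⟨z, hz⟩ := NormedSpace.exists_lt_norm ℝ (E N) (D + R)
  have hfar : ∀ x ∈ closure Ω, 2 ≤ l * (spread N p * ‖x - z‖ ^ 2) := by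
    intro x hx
    have h1 : R ≤ ‖x - z‖ := by
      have := norm_sub_norm_le z x
      rw [norm_sub_rev] at this
      linarith [hD x hx]
    calc 2 = l * (spread N p * R ^ 2) := by
          rw [hR, Real.sq_sqrt (by positivity)]; field_simp
      _ ≤ _ := by gcongr
  set f := gaussian l z with hf
  have hfm : Measurable f := (continuous_gaussian l z).measurable
  have hfC : ∀ x, |f x| ≤ 1 := fun x => by
    rw [abs_of_pos (gaussian_pos l z x)]; exact gaussian_le_one hl0.le z x
  set c := Real.exp (-(l * (D + ‖z‖) ^ 2)) * (1 / 2) with hc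
  have hc0 : 0 < c := by positivity
  set χ : E N → ℝ := (closure Ω).indicator fun _ => 1 with hχ
  have hχm : Measurable χ := measurable_const.indicator isClosed_closure.measurableSet
  have hχ0 : ∀ x, 0 ≤ χ x := fun x => indicator_nonneg (fun _ _ => zero_le_one) x
  have hχC : ∀ x, |χ x| ≤ 1 := fun x => by
    rw [abs_of_nonneg (hχ0 x)]
    exact indicator_le_self' (fun _ _ => zero_le_one) x
  have hstep : ∀ x, f x + c * χ x ≤ ∫ y, f y ∂(stepMeasure p ε σ x) := by
    intro x
    by_cases hx : x ∈ closure Ω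
    · have h1 := gaussian_mul_le_integral hp hε σ hx hl0.le hlε.le (hfar x hx)
      have h2 : Real.exp (-(l * (D + ‖z‖) ^ 2)) ≤ f x := by
        refine Real.exp_le_exp.2 (neg_le_neg ?_)
        gcongr
        exact (norm_sub_le x z).trans (by gcongr; exact hD x hx)
      rw [hlε] at h1
      rw [hχ, indicator_of_mem hx, mul_one, hc]
      linarith
    · rw [stepMeasure_of_notMem p ε σ hx, integral_dirac' _ _ hfm.stronglyMeasurable, hχ,
        indicator_of_notMem hx]
      simp
  set P := pathLaw hp hε σ x₀ with hP
  have hint := fun n => integrable_comp_eval hp hε σ x₀ n hfm hfC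
  have hintχ := fun n => integrable_comp_eval hp hε σ x₀ n hχm hχC
  have hsucc : ∀ n, ∫ ω, f (ω n) ∂P + c * ∫ ω, χ (ω n) ∂P ≤ ∫ ω, f (ω (n + 1)) ∂P := by
    intro n
    rw [integral_pathLaw_succ hp hε σ x₀ n hfm hfC, ← integral_const_mul,
      ← integral_add (hint n) ((hintχ n).const_mul c)]
    exact integral_mono ((hint n).add ((hintχ n).const_mul c))
      (integrable_integral_stepMeasure hp hε σ x₀ n hfm hfC) fun ω => hstep (ω n)
  have hsum : ∀ n, c * ∑ k ∈ Finset.range n, ∫ ω, χ (ω k) ∂P ≤ ∫ ω, f (ω n) ∂P := by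
    intro n
    induction n with
    | zero => simpa using integral_nonneg fun ω => (gaussian_pos l z (ω 0)).le
    | succ n ih =>
      rw [Finset.sum_range_succ, mul_add]
      linarith [hsucc n]
  have hle1 : ∀ n, ∫ ω, f (ω n) ∂P ≤ 1 := by
    intro n
    refine (integral_mono (hint n) (integrable_const 1) fun ω =>
      gaussian_le_one hl0.le z (ω n)).trans ?_
    simp
  refine (summable_of_sum_range_le (c := 1 / c) (f := fun n => ∫ ω, χ (ω n) ∂P)
    (fun n => integral_nonneg fun ω => hχ0 (ω n))
    fun n => ?_).tendsto_atTop_zero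
  rw [le_div_iff₀' hc0]
  exact (hsum n).trans (hle1 n)

/-- An exit within `δ` of `y₀` costs at most `K * δ`. A farther one costs at most `K * D` and
happens where `v = 1`. The estimate is made at a fixed time `n`, where paths still in `closure Ω`
add an error vanishing as `n → ∞`, so no optional stopping is needed. -/
theorem abs_integral_payoff_sub_le (hN : 2 ≤ N) (hp : 2 ≤ p) (hε : 0 < ε)
    (hΩ : Bornology.IsBounded Ω) {σ : Control Ω} {x₀ y₀ : E N} (hx₀ : x₀ ∈ closure Ω)
    {δ r m D : ℝ} (hδ : 0 ≤ δ) (hD0 : 0 ≤ D) {v : E N → ℝ} (hv : IsBarrier p ε σ y₀ δ r m v)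
    {K : ℝ≥0} {G : E N → ℝ} {T : Set (E N)} (hT : outerStrip Ω ε ⊆ T) (hG : LipschitzOnWith K G T)
    (hy₀ : y₀ ∈ T) (hD : ∀ x ∈ outerStrip Ω ε, dist x y₀ ≤ D) :
    |∫ ω, payoff Ω ε G ω ∂(pathLaw hp hε σ x₀) - G y₀| ≤ K * (δ + D * v x₀) := by
  have := isProbabilityMeasure_pathLaw hp hε σ x₀
  set P := pathLaw hp hε σ x₀ with hP
  -- Cutting off to the strip makes `G` measurable and bounded; nothing is known about it elsewhere
  -- off `T`.
  set g : E N → ℝ := (outerStrip Ω ε).indicator G with hg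
  have hgm : Measurable g := by
    classical
    rw [hg, ← piecewise_eq_indicator]
    exact (hG.continuousOn.mono hT).measurable_piecewise continuousOn_const
      (measurableSet_outerStrip Ω ε)
  have hGd : ∀ x ∈ outerStrip Ω ε, |G x - G y₀| ≤ K * dist x y₀ := fun x hx => by
    rw [← Real.dist_eq]; exact hG.dist_le_mul x (hT hx) y₀ hy₀
  have hgC : ∀ x, |g x| ≤ |G y₀| + K * D := by
    intro x
    by_cases hx : x ∈ outerStrip Ω ε
    · rw [hg, indicator_of_mem hx]
      have h1 := hGd x hx
      have h2 : K * dist x y₀ ≤ K * D := by gcongr; exact hD x hx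
      have h3 := abs_sub_abs_le_abs_sub (G x) (G y₀)
      linarith
    · rw [hg, indicator_of_notMem hx, abs_zero]; positivity
  have hlim : Filter.Tendsto (fun n => ∫ ω, g (ω n) ∂P) Filter.atTop
      (nhds (∫ ω, payoff Ω ε G ω ∂P)) := by
    refine tendsto_integral_of_dominated_convergence (fun _ => |G y₀| + K * D)
      (fun n => (integrable_comp_eval hp hε σ x₀ n hgm hgC).aestronglyMeasurable)
      (integrable_const _) (fun n => Filter.Eventually.of_forall fun ω => hgC (ω n)) ?_
    filter_upwards [ae_absorbed hp hε σ x₀] with ω hω using tendsto_payoff Ω ε G hω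
  set χ : E N → ℝ := (closure Ω).indicator fun _ => 1 with hχ
  have hχm : Measurable χ := measurable_const.indicator isClosed_closure.measurableSet
  have hχ0 : ∀ x, 0 ≤ χ x := fun x => indicator_nonneg (fun _ _ => zero_le_one) x
  have hχC : ∀ x, |χ x| ≤ 1 := fun x => by
    rw [abs_of_nonneg (hχ0 x)]
    exact indicator_le_self' (fun _ _ => zero_le_one) x
  have hvC : ∀ x, |v x| ≤ 1 := fun x => by rw [abs_of_nonneg (hv.nonneg x)]; exact hv.le_one x
  have hpoint : ∀ x ∈ enlarged Ω ε, |g x - G y₀| ≤ K * (δ + D * v x) + |G y₀| * χ x := by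
    intro x hx
    have hv0 := hv.nonneg x
    by_cases hxc : x ∈ closure Ω
    · rw [hg, indicator_of_notMem fun h => h.2 hxc, hχ, indicator_of_mem hxc, zero_sub, abs_neg,
        mul_one]
      have : 0 ≤ (K : ℝ) * (δ + D * v x) := by positivity
      linarith
    · have hxs : x ∈ outerStrip Ω ε := ⟨hx, hxc⟩
      rw [hg, indicator_of_mem hxs, hχ, indicator_of_notMem hxc, mul_zero, add_zero]
      refine (hGd x hxs).trans ?_
      gcongr
      rcases le_total δ (dist x y₀) with h | h
      · rw [hv.eq_one x h]
        linarith [hD x hxs]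
      · have := mul_nonneg hD0 hv0
        linarith
  have hbound : ∀ n, |∫ ω, g (ω n) ∂P - G y₀| ≤
      K * (δ + D * v x₀) + |G y₀| * ∫ ω, χ (ω n) ∂P := by
    intro n
    have hgi : Integrable (fun ω : ℕ → E N => g (ω n)) P :=
      integrable_comp_eval hp hε σ x₀ n hgm hgC
    have hvi : Integrable (fun ω : ℕ → E N => v (ω n)) P :=
      integrable_comp_eval hp hε σ x₀ n hv.measurable hvC
    have hχi : Integrable (fun ω : ℕ → E N => χ (ω n)) P :=
      integrable_comp_eval hp hε σ x₀ n hχm hχC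
    have hi1 : Integrable (fun ω : ℕ → E N => δ + D * v (ω n)) P :=
      (integrable_const δ).add (hvi.const_mul D)
    calc |∫ ω, g (ω n) ∂P - G y₀| = |∫ ω, (g (ω n) - G y₀) ∂P| := by
          rw [integral_sub hgi (integrable_const _)]; simp
      _ ≤ ∫ ω, |g (ω n) - G y₀| ∂P := abs_integral_le_integral_abs
      _ ≤ ∫ ω, (K * (δ + D * v (ω n)) + |G y₀| * χ (ω n)) ∂P := by
          refine integral_mono_ae (hgi.sub (integrable_const _)).abs
            ((hi1.const_mul _).add (hχi.const_mul _)) ?_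
          filter_upwards [ae_mem_enlarged hp hε σ hx₀] with ω hω using hpoint _ (hω n)
      _ = K * (δ + D * ∫ ω, v (ω n) ∂P) + |G y₀| * ∫ ω, χ (ω n) ∂P := by
          rw [integral_add (hi1.const_mul _) (hχi.const_mul _), integral_const_mul,
            integral_const_mul, integral_add (integrable_const δ) (hvi.const_mul D),
            integral_const_mul]
          simp
      _ ≤ _ := by gcongr; exact hv.integral_pathLaw_le hp hε x₀ n
  have hlim2 := (tendsto_integral_indicator_closure hN hp hε hΩ σ x₀).const_mul |G y₀|
  have := le_of_tendsto_of_tendsto' (hlim.sub_const (G y₀)).abs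
    (hlim2.const_add (K * (δ + D * v x₀))) hbound
  simpa using this

theorem nonempty_control (hN : 2 ≤ N) (Ω : Set (E N)) : Nonempty (Control Ω) := by
  have : Nonempty (Fin N) := ⟨⟨0, by omega⟩⟩
  obtain ⟨e, he⟩ := exists_norm_eq (E N) zero_le_one
  exact ⟨⟨fun _ => ⟨e, by simpa using he⟩, measurable_const⟩⟩

theorem abs_ciSup_sub_le {ι : Type*} [Nonempty ι] {f : ι → ℝ} {a b : ℝ}
    (h : ∀ i, |f i - a| ≤ b) : |(⨆ i, f i) - a| ≤ b := by
  have hub : ∀ i, f i ≤ a + b := fun i => by linarith [(abs_le.1 (h i)).2]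
  have hbdd : BddAbove (range f) := ⟨a + b, by rintro _ ⟨i, rfl⟩; exact hub i⟩
  obtain ⟨i⟩ := ‹Nonempty ι›
  refine abs_le.2 ⟨?_, ?_⟩
  · linarith [(abs_le.1 (h i)).1, le_ciSup hbdd i]
  · have : Nonempty ι := ⟨i⟩
    linarith [ciSup_le hub]

end DominativeGame

end

/-! ### Choice of constants -/

theorem lemma2p6 {N : ℕ} (hN : 2 ≤ N) {p : ℝ} (hp : 2 ≤ p)
    {Ω : Set (DominativeGame.E N)} (hΩ : DominativeGame.IsBoundedLipschitzDomain Ω)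
    {K : ℝ≥0} {F : DominativeGame.E N → ℝ} (hF : LipschitzOnWith K F (frontier Ω)) :
    ∀ η : ℝ, 0 < η → ∃ ε₀ : ℝ, 0 < ε₀ ∧ ∃ ε₁ : ℝ, 0 < ε₁ ∧
      ∀ y₀ ∈ frontier Ω, ∀ (ε : ℝ) (hε : 0 < ε), ε < ε₀ →
        ∀ G : DominativeGame.E N → ℝ, EqOn G F (frontier Ω) →
          LipschitzOnWith K G (frontier Ω ∪ DominativeGame.outerStrip Ω ε) →
            ∀ x ∈ ball y₀ ε₁ ∩ closure Ω,
              |DominativeGame.stochasticSolution hp hε Ω G x - F y₀| ≤ η := by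
  intro η hη
  obtain ⟨r₀, hr₀, ρ, hρ, hρ1, hext⟩ := hΩ.exists_exterior_ball
  have hs := DominativeGame.spread_pos hN hp
  have hbdd : Bornology.IsBounded (cthickening 1 Ω) := hΩ.isBounded.cthickening
  set D := diam (cthickening 1 Ω) with hDdef
  have hD0 : 0 ≤ D := diam_nonneg
  -- Near and far exits each get `η / 2`; `K + 1` and `D + 1` avoid division by zero.
  set δ := min r₀ (η / (2 * (K + 1))) with hδdef
  have hδ : 0 < δ := lt_min hr₀ (by positivity)
  obtain ⟨n, hn⟩ := exists_pow_lt_of_lt_one (show 0 < η / (2 * (K + 1) * (D + 1)) by positivity)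
    (DominativeGame.barrierRatio_lt_one hN hp hρ)
  -- The bound `1` keeps every strip inside `cthickening 1 Ω`, so `D` serves all `ε`; the other
  -- bound makes `n` barrier scales available.
  refine ⟨min 1 (DominativeGame.spread N p * ρ / 4 * (δ / 8 ^ n)),
    lt_min one_pos (by positivity), δ / 8 ^ n, by positivity, ?_⟩
  intro y₀ hy₀ ε hε hεlt G hGF hG x hx
  have := DominativeGame.nonempty_control hN Ω
  rw [← hGF hy₀]
  refine DominativeGame.abs_ciSup_sub_le fun σ => ?_
  obtain ⟨v, hv⟩ := DominativeGame.exists_isBarrier hN hp hρ hρ1 hδ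
    (fun r hr hrδ => hext y₀ hy₀ r hr (hrδ.trans (min_le_left _ _))) hε σ n
    (hεlt.le.trans (min_le_right _ _))
  have hDist : ∀ z ∈ DominativeGame.outerStrip Ω ε, dist z y₀ ≤ D := fun z hz =>
    dist_le_diam_of_mem hbdd (cthickening_mono (hεlt.le.trans (min_le_left _ _)) Ω hz.1)
      (closure_subset_cthickening 1 Ω (frontier_subset_closure hy₀))
  refine (DominativeGame.abs_integral_payoff_sub_le hN hp hε hΩ.isBounded hx.2 hδ.le hD0 hv
    subset_union_right hG (Or.inl hy₀) hDist).trans ?_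
  have hvx : v x ≤ η / (2 * (K + 1) * (D + 1)) :=
    (hv.le_of_dist_le x (mem_ball.1 hx.1).le).trans hn.le
  calc (K : ℝ) * (δ + D * v x)
      ≤ (K + 1) * (η / (2 * (K + 1)) + (D + 1) * (η / (2 * (K + 1) * (D + 1)))) := by
        have := hv.nonneg x
        gcongr
        · linarith
        · exact min_le_right _ _
        · linarith
    _ = η := by field_simp; norm_num
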